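/- **Theorem (strong converse of the Heisenberg limit for information replication).** Let $\mathcal H$ be a finite-dimensional complex Hilbert space, $H=H^\dagger$ an operator on $\mathcal H$, and $|\psi\rangle\in\mathcal H$ a unit vector that is not an eigenvector of $H$. Write $U_t=e^{-itH}$ and $|\psi_t\rangle=U_t|\psi\rangle$ for $t\in\mathbb R$. A *replication process* from $N$ to $M$ copies is a completely positive, trace non-increasing linear map $\mathcal P$ from operators on $\mathcal H^{\otimes N}$ to operators on $\mathcal H^{\otimes M}$ that is covariant, i.e. $$U_t^{\otimes M}\,\mathcal P(\rho)\,U_t^{\otimes M\dagger}=\mathcal P\big(U_t^{\otimes N}\rho\,U_t^{\otimes N\dagger}\big)\qquad\text{for all } t\in\mathbb R \text{ and all } \rho,$$ and that succeeds on the clock states with non-zero probability, i.e. $\operatorname{Tr}\mathcal P\big[(|\psi_t\rangle\langle\psi_t|)^{\otimes N}\big]>0$ for all $t$. Its worst-case global fidelity, conditional on success, is $$F(\mathcal P)=\inf_{t\in\mathbb R}\frac{\langle\psi_t|^{\otimes M}\,\mathcal P\big[(|\psi_t\rangle\langle\psi_t|)^{\otimes N}\big]\,|\psi_t\rangle^{\otimes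 M}}{\operatorname{Tr}\mathcal P\big[(|\psi_t\rangle\langle\psi_t|)^{\otimes N}\big]} .$$ Let $c>0$ and $\epsilon>0$, and let $(\mathcal P_N)_{N\in\mathbb N}$ be a sequence of replication processes, $\mathcal P_N$ going from $N$ to $M(N)$ copies with $M(N)\ge c\,N^{2+\epsilon}$ for every $N$. Then $$\lim_{N\to\infty}F(\mathcal P_N)=0 .$$ -/

import Mathlib

open scoped Matrix Matrix.Norms.L2Operator MatrixOrder CStarAlgebra ComplexOrder

noncomputable section

namespace Replication

variable {ι : Type*} [Fintype ι] [DecidableEq ι]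

/-- The time evolution `U_t = exp(-i t H)` on `ℂ^ι`. -/
def timeEvolution (H : Matrix ι ι ℂ) (t : ℝ) : Matrix ι ι ℂ :=
  NormedSpace.exp ((-(Complex.I * (t : ℂ))) • H)

/-- The clock state `|ψ_t⟩ = exp(-i t H) |ψ⟩`. -/
def clockState (H : Matrix ι ι ℂ) (ψ : ι → ℂ) (t : ℝ) : ι → ℂ :=
  timeEvolution H t *ᵥ ψ

/-- `v^{⊗ n}`, a vector of `(ℂ^ι)^{⊗ n} = ℂ^(ι^n)`, in the product basis indexed by `Fin n → ι`. -/
def tensorPowerVec (n : ℕ) (v : ι → ℂ) : (Fin n → ι) → ℂ :=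
  fun x => ∏ j, v (x j)

/-- `A^{⊗ n}`, an operator on `(ℂ^ι)^{⊗ n}`, in the product basis indexed by `Fin n → ι`. -/
def tensorPowerMat (n : ℕ) (A : Matrix ι ι ℂ) : Matrix (Fin n → ι) (Fin n → ι) ℂ :=
  Matrix.of fun x y => ∏ j, A (x j) (y j)

/-- The rank-one operator `|v⟩⟨v|`. -/
def pureState {κ : Type*} (v : κ → ℂ) : Matrix κ κ ℂ :=
  Matrix.vecMulVec v (star v)

/-- A probabilistic replication process from `N` to `M` copies of a system with Hamiltonian `H`:
the successful branch of a quantum instrument, that is, a completely positive trace non-increasing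
linear map from operators on `(ℂ^ι)^{⊗ N}` to operators on `(ℂ^ι)^{⊗ M}`, which is covariant under
the time evolution. (By linearity it is the same to require covariance on density matrices or on
all operators.) -/
structure ReplicationProcess (H : Matrix ι ι ℂ) (N M : ℕ) where
  /-- The underlying completely positive map. -/
  map : Matrix (Fin N → ι) (Fin N → ι) ℂ →CP Matrix (Fin M → ι) (Fin M → ι) ℂ
  trace_le : ∀ ρ : Matrix (Fin N → ι) (Fin N → ι) ℂ, ρ.PosSemidef →
    (map ρ).trace.re ≤ ρ.trace.re
  covariant : ∀ (t : ℝ) (ρ : Matrix (Fin N → ι) (Fin N → ι) ℂ),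
    tensorPowerMat M (timeEvolution H t) * map ρ * (tensorPowerMat M (timeEvolution H t))ᴴ =
      map (tensorPowerMat N (timeEvolution H t) * ρ * (tensorPowerMat N (timeEvolution H t))ᴴ)

namespace ReplicationProcess

variable {H : Matrix ι ι ℂ} {N M : ℕ}

/-- The (unnormalised) output on the input `|ψ_t⟩^{⊗ N}` when the process succeeds. -/
def output (P : ReplicationProcess H N M) (ψ : ι → ℂ) (t : ℝ) :
    Matrix (Fin M → ι) (Fin M → ι) ℂ :=
  P.map (pureState (tensorPowerVec N (clockState H ψ t)))

/-- The probability that the process succeeds on the input `|ψ_t⟩^{⊗ N}`. -/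
def successProbability (P : ReplicationProcess H N M) (ψ : ι → ℂ) (t : ℝ) : ℝ :=
  (P.output ψ t).trace.re

/-- The global fidelity of the output, conditional on success, with `|ψ_t⟩^{⊗ M}`. -/
def fidelity (P : ReplicationProcess H N M) (ψ : ι → ℂ) (t : ℝ) : ℝ :=
  (star (tensorPowerVec M (clockState H ψ t)) ⬝ᵥ
    (P.output ψ t *ᵥ tensorPowerVec M (clockState H ψ t))).re / P.successProbability ψ t

/-- The worst-case fidelity over all clock states. -/
def worstCaseFidelity (P : ReplicationProcess H N M) (ψ : ι → ℂ) : ℝ :=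
  ⨅ t : ℝ, P.fidelity ψ t

end ReplicationProcess

end Replication

end

open MeasureTheory ProbabilityTheory

noncomputable section

namespace Replication

variable {ι : Type*}

/-! In a product eigenbasis of `H`, the entries of an operator on N copies oscillate in time with
frequencies of size at most NΔ, where Δ bounds the eigenvalue gaps. Covariance preserves
frequencies, so the output on M copies is banded in energy with width NΔ
(`apply_eq_zero_of_covariant`). A positive banded matrix overlaps a vector by at most its trace
times the largest mass the vector gives to an energy window of half-width NΔ
(`re_dotProduct_mulVec_le_of_banded`).

The energy of the M-copy target is a sum of M i.i.d. variables, nondegenerate because ψ is not an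
eigenvector. Its spread is of order √M, far beyond N when M ≥ cN^(2+ε), so every window has
vanishing mass. `sum_ite_abs_sub_le_integral` bounds that mass by the characteristic function, and
`tendsto_integral_norm_pow` gives the limit. -/

theorem tensorPowerMat_mul [Fintype ι] (n : ℕ) (A B : Matrix ι ι ℂ) :
    tensorPowerMat n (A * B) = tensorPowerMat n A * tensorPowerMat n B := by
  ext x y
  simp only [tensorPowerMat, Matrix.of_apply, Matrix.mul_apply, ← Finset.prod_mul_distrib]
  rw [Finset.prod_univ_sum, Fintype.piFinset_univ]

theorem tensorPowerMat_mulVec [Fintype ι] (n : ℕ) (A : Matrix ι ι ℂ) (v : ι → ℂ) :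
    tensorPowerVec n (A *ᵥ v) = tensorPowerMat n A *ᵥ tensorPowerVec n v := by
  ext x
  simp only [tensorPowerMat, tensorPowerVec, Matrix.of_apply, Matrix.mulVec, dotProduct,
    ← Finset.prod_mul_distrib]
  rw [Finset.prod_univ_sum, Fintype.piFinset_univ]

theorem tensorPowerMat_diagonal [DecidableEq ι] (n : ℕ) (d : ι → ℂ) :
    tensorPowerMat n (Matrix.diagonal d) = Matrix.diagonal (tensorPowerVec n d) := by
  ext x y
  simp only [tensorPowerMat, Matrix.of_apply]
  by_cases h : x = y
  · subst h; simp [tensorPowerVec]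
  · obtain ⟨j, hj⟩ := Function.ne_iff.mp h
    rw [Matrix.diagonal_apply_ne _ h]
    exact Finset.prod_eq_zero (Finset.mem_univ j) (Matrix.diagonal_apply_ne _ hj)

theorem tensorPowerMat_one [DecidableEq ι] (n : ℕ) : tensorPowerMat n (1 : Matrix ι ι ℂ) = 1 := by
  rw [← Matrix.diagonal_one, tensorPowerMat_diagonal, ← Matrix.diagonal_one]
  congr 1
  ext x
  simp [tensorPowerVec]

theorem tensorPowerMat_conjTranspose (n : ℕ) (A : Matrix ι ι ℂ) :
    tensorPowerMat n Aᴴ = (tensorPowerMat n A)ᴴ := by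
  ext x y
  simp [tensorPowerMat, Matrix.conjTranspose_apply]

theorem timeEvolution_zero [Fintype ι] [DecidableEq ι] (H : Matrix ι ι ℂ) : timeEvolution H 0 = 1 := by
  simp [timeEvolution, NormedSpace.exp_zero]

/-- Diagonalization of the time evolution of a Hermitian Hamiltonian. -/
theorem exists_timeEvolution_eq [Fintype ι] [DecidableEq ι] {H : Matrix ι ι ℂ} (hH : H.IsHermitian) :
    ∃ (V : Matrix ι ι ℂ) (lam : ι → ℝ), Vᴴ * V = 1 ∧ V * Vᴴ = 1 ∧
      H = V * Matrix.diagonal (fun i => (lam i : ℂ)) * Vᴴ ∧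
      ∀ t : ℝ, timeEvolution H t =
        V * Matrix.diagonal (fun i => Complex.exp (-(Complex.I * t * lam i))) * Vᴴ := by
  set V : Matrix ι ι ℂ := (hH.eigenvectorUnitary : Matrix ι ι ℂ) with hV
  have h1 : Vᴴ * V = 1 := Matrix.mem_unitaryGroup_iff'.mp hH.eigenvectorUnitary.2
  have h2 : V * Vᴴ = 1 := Matrix.mem_unitaryGroup_iff.mp hH.eigenvectorUnitary.2
  have h3 : H = V * Matrix.diagonal (fun i => (hH.eigenvalues i : ℂ)) * Vᴴ := by
    conv_lhs => rw [hH.spectral_theorem]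
    rfl
  refine ⟨V, hH.eigenvalues, h1, h2, h3, fun t => ?_⟩
  have h4 : (-(Complex.I * (t : ℂ))) • H =
      V * Matrix.diagonal (fun i => -(Complex.I * t * hH.eigenvalues i)) * V⁻¹ := by
    rw [Matrix.inv_eq_right_inv h2]
    conv_lhs => rw [h3]
    rw [← Matrix.smul_mul, ← Matrix.mul_smul, ← Matrix.diagonal_smul]
    congr 3
    ext i
    simp [mul_assoc]
  rw [timeEvolution, h4, Matrix.exp_conj _ _ (IsUnit.of_mul_eq_one _ h2), Matrix.exp_diagonal,
    Matrix.inv_eq_right_inv h2]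
  congr 3
  ext i
  simp [Complex.exp_eq_exp_ℂ, NormedSpace.exp, Pi.coe_exp]

/-- A finite sum of exponentials of frequencies different from `ω` is not a nonzero multiple of the
exponential of frequency `ω`. -/
theorem eq_zero_of_exp_eq_sum {κ : Type*} [Fintype κ] (ω : ℝ) (w : κ → ℝ) (b : ℂ) (c : κ → ℂ)
    (hw : ∀ k, w k ≠ ω)
    (h : ∀ t : ℝ, Complex.exp (-(Complex.I * t * ω)) * b =
      ∑ k, Complex.exp (-(Complex.I * t * w k)) * c k) : b = 0 := by
  -- Exponentials are characters of the additive group ℝ, so Dedekind's independence of characters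
  -- applies once distinct frequencies are known to give distinct characters; the derivative at 0
  -- shows this.
  let χ : ℝ → (Multiplicative ℝ →* ℂ) := fun ω =>
    { toFun := fun t => Complex.exp (-(Complex.I * (t.toAdd : ℝ) * ω))
      map_one' := by simp
      map_mul' := fun s t => by
        rw [← Complex.exp_add]; congr 1; push_cast [toAdd_mul]; ring }
  have hχ : Function.Injective χ := by
    intro x y hxy
    have hd : ∀ z : ℝ, HasDerivAt (fun t : ℝ => Complex.exp (-(Complex.I * t * z)))
        (-(Complex.I * z)) 0 := by
      intro z
      have h0 : HasDerivAt (fun t : ℝ => -(Complex.I * (t : ℂ) * z)) (-(Complex.I * z)) 0 := by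
        simpa using
          (((hasDerivAt_id (0 : ℝ)).ofReal_comp.const_mul Complex.I).mul_const (z : ℂ)).fun_neg
      simpa using h0.cexp
    have hf : (fun t : ℝ => Complex.exp (-(Complex.I * t * x))) =
        fun t : ℝ => Complex.exp (-(Complex.I * t * y)) := by
      ext t
      exact DFunLike.congr_fun hxy (Multiplicative.ofAdd t)
    have := (hd x).unique (hf ▸ hd y)
    simpa using this
  by_contra hb
  have hli := linearIndependent_monoidHom (Multiplicative ℝ) ℂ
  have hn := hli.notMem_span_image (s := Set.range fun k => χ (w k)) (x := χ ω)
    (by rintro ⟨k, hk⟩; exact hw k (hχ hk))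
  apply hn
  have he : (χ ω : Multiplicative ℝ → ℂ) = b⁻¹ • ∑ k, c k • (χ (w k) : Multiplicative ℝ → ℂ) := by
    ext t
    have := h t.toAdd
    simp only [Pi.smul_apply, Finset.sum_apply, smul_eq_mul]
    rw [eq_inv_mul_iff_mul_eq₀ hb, mul_comm]
    refine this.trans (Finset.sum_congr rfl fun k _ => mul_comm _ _)
  change (χ ω : Multiplicative ℝ → ℂ) ∈ _
  rw [he]
  refine Submodule.smul_mem _ _ (Submodule.sum_mem _ fun k _ => Submodule.smul_mem _ _ ?_)
  exact Submodule.subset_span ⟨χ (w k), ⟨k, rfl⟩, rfl⟩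

/-! ### Banded positive matrices and covariance -/

/-- This is nonnegativity of the 2×2 principal minor on u, v. -/
theorem norm_apply_sq_le_of_posSemidef {κ : Type*} [Fintype κ] {B : Matrix κ κ ℂ}
    (hB : B.PosSemidef) (u v : κ) : ‖B u v‖ ^ 2 ≤ (B u u).re * (B v v).re := by
  have h := (hB.submatrix ![u, v]).det_nonneg
  rw [Matrix.det_fin_two] at h
  simp only [Matrix.submatrix_apply, Matrix.cons_val_zero, Matrix.cons_val_one] at h
  have h1 : B v u = star (B u v) := (hB.isHermitian.apply v u).symm
  have h2 : ∀ w, (B w w).im = 0 := fun w => Complex.conj_eq_iff_im.mp (hB.isHermitian.apply w w)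
  rw [h1] at h
  have h3 := (Complex.le_def.mp h).1
  rw [← Complex.normSq_eq_norm_sq, Complex.normSq_apply]
  simp [h2] at h3
  linarith

/-- Overlap of a banded positive semidefinite matrix with a vector that is spread out. -/
theorem re_dotProduct_mulVec_le_of_banded {κ : Type*} [Fintype κ] {B : Matrix κ κ ℂ}
    (hB : B.PosSemidef) (Λ : κ → ℝ) (D : ℝ) (hD : ∀ u v, D < |Λ u - Λ v| → B u v = 0)
    (Φ : κ → ℂ) (δ : ℝ) (hδ : ∀ s, (∑ v, if |Λ v - s| ≤ D then ‖Φ v‖ ^ 2 else 0) ≤ δ) :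
    (star Φ ⬝ᵥ (B *ᵥ Φ)).re ≤ δ * B.trace.re := by
  have hd : ∀ w, 0 ≤ (B w w).re := fun w => (Complex.le_def.mp (hB.diag_nonneg (i := w))).1
  -- AM-GM pairs each diagonal entry with the weight of the other index, so that summing over the
  -- latter leaves a window mass centred at the former's energy.
  have hterm : ∀ u v, (star (Φ u) * (B u v * Φ v)).re ≤
      ((B u u).re * (if |Λ v - Λ u| ≤ D then ‖Φ v‖ ^ 2 else 0) +
        (B v v).re * (if |Λ u - Λ v| ≤ D then ‖Φ u‖ ^ 2 else 0)) / 2 := by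
    intro u v
    rw [abs_sub_comm (Λ v)]
    split_ifs with h
    · refine (Complex.re_le_norm _).trans ?_
      rw [norm_mul, norm_mul, norm_star]
      have h1 := norm_apply_sq_le_of_posSemidef hB u v
      have h2 : ‖B u v‖ ≤ √(B u u).re * √(B v v).re := by
        rw [← Real.sqrt_mul (hd u)]; exact Real.le_sqrt_of_sq_le h1
      have h3 := Real.sq_sqrt (hd u)
      have h4 := Real.sq_sqrt (hd v)
      calc ‖Φ u‖ * (‖B u v‖ * ‖Φ v‖)
          ≤ ‖Φ u‖ * (√(B u u).re * √(B v v).re * ‖Φ v‖) := by gcongr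
        _ ≤ (√(B u u).re ^ 2 * ‖Φ v‖ ^ 2 + √(B v v).re ^ 2 * ‖Φ u‖ ^ 2) / 2 := by
            nlinarith [sq_nonneg (√(B u u).re * ‖Φ v‖ - √(B v v).re * ‖Φ u‖)]
        _ = _ := by rw [h3, h4]
    · rw [hD u v (not_le.mp h)]; simp
  have hsum : (star Φ ⬝ᵥ (B *ᵥ Φ)).re = ∑ u, ∑ v, (star (Φ u) * (B u v * Φ v)).re := by
    simp only [dotProduct, Matrix.mulVec, Finset.mul_sum, Complex.re_sum, Pi.star_apply]
  rw [hsum]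
  refine (Finset.sum_le_sum fun u _ => Finset.sum_le_sum fun v _ => hterm u v).trans ?_
  simp only [← Finset.sum_div, Finset.sum_add_distrib]
  rw [Finset.sum_comm (f := fun u v => (B v v).re * _)]
  simp only [← Finset.mul_sum, add_self_div_two]
  rw [Matrix.trace, Complex.re_sum, Finset.mul_sum]
  refine Finset.sum_le_sum fun u _ => ?_
  rw [mul_comm δ]
  exact mul_le_mul_of_nonneg_left (hδ _) (hd u)

/-- Total energy of a product basis vector. -/
def totalEnergy (lam : ι → ℝ) {n : ℕ} (x : Fin n → ι) : ℝ := ∑ j, lam (x j)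

theorem tensorPowerVec_exp (n : ℕ) (z : ℂ) (lam : ι → ℝ) :
    tensorPowerVec n (fun i => Complex.exp (z * lam i)) =
      fun x => Complex.exp (z * totalEnergy lam x) := by
  ext x
  simp [tensorPowerVec, totalEnergy, ← Complex.exp_sum, Finset.mul_sum]

theorem abs_totalEnergy_sub_le {lam : ι → ℝ} {Δ : ℝ} (hΔ : ∀ i j, |lam i - lam j| ≤ Δ) {n : ℕ}
    (x y : Fin n → ι) : |totalEnergy lam x - totalEnergy lam y| ≤ n * Δ := by
  rw [totalEnergy, totalEnergy, ← Finset.sum_sub_distrib]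
  refine (Finset.abs_sum_le_sum_abs _ _).trans ?_
  refine (Finset.sum_le_sum fun j _ => hΔ (x j) (y j)).trans ?_
  simp

/-- A linear map covariant under diagonal evolutions produces banded matrices. -/
theorem apply_eq_zero_of_covariant {κ μ : Type*} [Fintype κ] [DecidableEq κ] [Fintype μ]
    [DecidableEq μ] (L : Matrix κ κ ℂ →ₗ[ℂ] Matrix μ μ ℂ) (Λ : κ → ℝ) (Λ' : μ → ℝ)
    (hL : ∀ (t : ℝ) (X : Matrix κ κ ℂ),
      Matrix.diagonal (fun u => Complex.exp (-(Complex.I * t) * Λ' u)) * L X *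
        (Matrix.diagonal fun u => Complex.exp (-(Complex.I * t) * Λ' u))ᴴ =
      L (Matrix.diagonal (fun x => Complex.exp (-(Complex.I * t) * Λ x)) * X *
        (Matrix.diagonal fun x => Complex.exp (-(Complex.I * t) * Λ x))ᴴ))
    {D : ℝ} (hD : ∀ x y, |Λ x - Λ y| ≤ D) (X : Matrix κ κ ℂ) {u v : μ}
    (huv : D < |Λ' u - Λ' v|) : L X u v = 0 := by
  have hphase : ∀ (t a b : ℝ), Complex.exp (-(Complex.I * t) * a) *
      star (Complex.exp (-(Complex.I * t) * b)) =
        Complex.exp (-(Complex.I * t * ((a - b : ℝ) : ℂ))) := by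
    intro t a b
    rw [← starRingEnd_apply, ← Complex.exp_conj, ← Complex.exp_add]
    congr 1
    simp
    ring
  -- Expand `X` in matrix units: covariance writes an oscillation at the output frequency as a
  -- combination of input frequencies, all of size at most `D`.
  refine eq_zero_of_exp_eq_sum (κ := κ × κ) (Λ' u - Λ' v) (fun k => Λ k.1 - Λ k.2) _
    (fun k => L (Matrix.single k.1 k.2 (X k.1 k.2)) u v) ?_ ?_
  · intro k hk
    have := hD k.1 k.2
    rw [hk] at this
    exact absurd this (not_le.mpr huv)
  · intro t
    have h1 : Matrix.diagonal (fun x => Complex.exp (-(Complex.I * t) * Λ x)) * X *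
        (Matrix.diagonal fun x => Complex.exp (-(Complex.I * t) * Λ x))ᴴ =
        ∑ x, ∑ y, Complex.exp (-(Complex.I * t * ((Λ x - Λ y : ℝ) : ℂ))) •
          Matrix.single x y (X x y) := by
      conv_lhs => rw [Matrix.matrix_eq_sum_single (Matrix.diagonal _ * X * _)]
      refine Finset.sum_congr rfl fun x _ => Finset.sum_congr rfl fun y _ => ?_
      rw [Matrix.smul_single, Matrix.diagonal_conjTranspose, Matrix.mul_diagonal,
        Matrix.diagonal_mul, ← hphase]
      congr 1
      simp only [Pi.star_apply, smul_eq_mul]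
      ring
    have h2 := congrFun (congrFun (hL t X) u) v
    rw [h1, Matrix.diagonal_conjTranspose, Matrix.mul_diagonal, Matrix.diagonal_mul] at h2
    rw [← hphase]
    calc _ = _ := by rw [mul_right_comm]; rfl
      _ = _ := h2
      _ = _ := by
        rw [Fintype.sum_prod_type]
        simp only [map_sum, map_smul, Matrix.sum_apply, Matrix.smul_apply, smul_eq_mul]

/-! ### Energy spreading via characteristic functions -/

/-- Small-ball probabilities are controlled by a Gaussian average of the characteristic function. -/
theorem sum_ite_abs_sub_le_integral {κ : Type*} [Fintype κ] (q : κ → ℝ) (hq : ∀ v, 0 ≤ q v)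
    (Λ : κ → ℝ) {D : ℝ} (hD : 0 < D) (s : ℝ) :
    (∑ v, if |Λ v - s| ≤ D then q v else 0) ≤
      Real.exp (1 / 2) * ∫ g, ‖∑ v, (q v : ℂ) * Complex.exp ((g / D : ℝ) * Complex.I * Λ v)‖
        ∂(gaussianReal 0 1) := by
  -- The indicator of [-1, 1] is at most e^(1/2) e^(-x²/2), and this Gaussian is itself the
  -- characteristic function of a standard normal variable.
  have h1 : ∀ v, (if |Λ v - s| ≤ D then q v else 0) ≤
      Real.exp (1 / 2) * (q v * Real.exp (-((Λ v - s) / D) ^ 2 / 2)) := by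
    intro v
    split_ifs with h
    · rw [mul_left_comm, ← Real.exp_add]
      refine le_mul_of_one_le_right (hq v) (Real.one_le_exp ?_)
      have : ((Λ v - s) / D) ^ 2 ≤ 1 := by
        rw [sq_le_one_iff_abs_le_one, abs_div, abs_of_pos hD]
        exact (div_le_one hD).mpr h
      linarith
    · have := hq v
      positivity
  refine (Finset.sum_le_sum fun v _ => h1 v).trans ?_
  rw [← Finset.mul_sum]
  refine mul_le_mul_of_nonneg_left ?_ (Real.exp_pos _).le
  have hint : ∀ v, Integrable (fun g : ℝ => (q v : ℂ) *
      Complex.exp (((Λ v - s) / D : ℝ) * g * Complex.I)) (gaussianReal 0 1) := by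
    intro v
    refine Integrable.of_bound (C := q v) (Continuous.aestronglyMeasurable (by fun_prop))
      (Filter.Eventually.of_forall fun g => ?_)
    rw [norm_mul, ← Complex.ofReal_mul, Complex.norm_exp_ofReal_mul_I, mul_one,
      Complex.norm_real, Real.norm_of_nonneg (hq v)]
  have h2 : ((∑ v, q v * Real.exp (-((Λ v - s) / D) ^ 2 / 2) : ℝ) : ℂ) =
      ∫ g, ∑ v, (q v : ℂ) * Complex.exp (((Λ v - s) / D : ℝ) * g * Complex.I)
        ∂(gaussianReal 0 1) := by
    rw [integral_finsetSum _ fun v _ => hint v, Complex.ofReal_sum]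
    refine Finset.sum_congr rfl fun v _ => ?_
    rw [integral_const_mul, ← charFun_apply_real, charFun_gaussianReal]
    push_cast
    congr 2
    simp [neg_div]
  have h3 : (0 : ℝ) ≤ ∑ v, q v * Real.exp (-((Λ v - s) / D) ^ 2 / 2) :=
    Finset.sum_nonneg fun v _ => mul_nonneg (hq v) (Real.exp_pos _).le
  rw [← Real.norm_of_nonneg h3, ← Complex.norm_real, h2]
  refine (norm_integral_le_integral_norm _).trans (le_of_eq (integral_congr_ae
    (Filter.Eventually.of_forall fun g => ?_)))
  -- The centre `s` enters only through a phase, so the bound is uniform in `s`.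
  have h4 : ∑ v, (q v : ℂ) * Complex.exp (((Λ v - s) / D : ℝ) * g * Complex.I) =
      Complex.exp ((-(s / D * g) : ℝ) * Complex.I) *
        ∑ v, (q v : ℂ) * Complex.exp ((g / D : ℝ) * Complex.I * Λ v) := by
    rw [Finset.mul_sum]
    refine Finset.sum_congr rfl fun v _ => ?_
    rw [mul_left_comm, ← Complex.exp_add]
    congr 2
    push_cast
    ring
  simp only [h4]
  rw [norm_mul, Complex.norm_exp_ofReal_mul_I, one_mul]

theorem sum_prod_mul_exp_totalEnergy [Fintype ι] (p lam : ι → ℝ) (z : ℂ) (n : ℕ) :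
    ∑ x : Fin n → ι, ((∏ j, p (x j) : ℝ) : ℂ) * Complex.exp (z * totalEnergy lam x) =
      (∑ i, (p i : ℂ) * Complex.exp (z * lam i)) ^ n := by
  have h := (Finset.prod_univ_sum (fun _ : Fin n => (Finset.univ : Finset ι))
    (fun _ i => (p i : ℂ) * Complex.exp (z * lam i)))
  rw [Finset.prod_const, Finset.card_univ, Fintype.card_fin, Fintype.piFinset_univ] at h
  rw [h]
  refine Finset.sum_congr rfl fun x _ => ?_
  rw [Finset.prod_mul_distrib, ← Complex.exp_sum, totalEnergy]
  push_cast
  rw [Finset.mul_sum]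

/-- The characteristic function of a finitely supported probability measure which charges two
different points decays quadratically near the origin. -/
theorem norm_sum_mul_exp_le [Fintype ι] {p : ι → ℝ} (lam : ι → ℝ) (hp : ∀ i, 0 ≤ p i)
    (hp1 : ∑ i, p i = 1) (a b : ι) {t : ℝ} (ht : |t * (lam a - lam b)| ≤ Real.pi) :
    ‖∑ i, (p i : ℂ) * Complex.exp (t * Complex.I * lam i)‖ ≤
      Real.exp (-(p a * p b * (lam a - lam b) ^ 2 / Real.pi ^ 2) * t ^ 2) := by
  set z : ℂ := ∑ i, (p i : ℂ) * Complex.exp (t * Complex.I * lam i) with hz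
  -- The squared modulus is the characteristic function of the difference of two independent copies.
  have hz2 : ‖z‖ ^ 2 = ∑ i, ∑ j, p i * p j * Real.cos (t * (lam i - lam j)) := by
    have hzz : z = ∑ i, (p i : ℂ) * Complex.exp ((t * lam i : ℝ) * Complex.I) := by
      rw [hz]
      refine Finset.sum_congr rfl fun i _ => ?_
      congr 2
      push_cast
      ring
    have hre : z.re = ∑ i, p i * Real.cos (t * lam i) := by
      simp [hzz, Complex.exp_ofReal_mul_I_re, -Complex.ofReal_mul]
    have him : z.im = ∑ i, p i * Real.sin (t * lam i) := by
      simp [hzz, Complex.exp_ofReal_mul_I_im, -Complex.ofReal_mul]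
    rw [← Complex.normSq_eq_norm_sq, Complex.normSq_apply, hre, him, Finset.sum_mul_sum,
      Finset.sum_mul_sum, ← Finset.sum_add_distrib]
    refine Finset.sum_congr rfl fun i _ => ?_
    rw [← Finset.sum_add_distrib]
    refine Finset.sum_congr rfl fun j _ => ?_
    rw [mul_sub, Real.cos_sub]
    ring
  have h1 : 1 - ‖z‖ ^ 2 = ∑ i, ∑ j, p i * p j * (1 - Real.cos (t * (lam i - lam j))) := by
    have h0 : (1 : ℝ) = ∑ i, ∑ j, p i * p j := by rw [← Finset.sum_mul_sum, hp1, one_mul]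
    rw [hz2]
    nth_rw 1 [h0]
    rw [← Finset.sum_sub_distrib]
    refine Finset.sum_congr rfl fun i _ => ?_
    rw [← Finset.sum_sub_distrib]
    refine Finset.sum_congr rfl fun j _ => ?_
    ring
  have hnn : ∀ i j, 0 ≤ p i * p j * (1 - Real.cos (t * (lam i - lam j))) := fun i j =>
    mul_nonneg (mul_nonneg (hp i) (hp j)) (sub_nonneg.mpr (Real.cos_le_one _))
  have h2 : p a * p b * (1 - Real.cos (t * (lam a - lam b))) ≤ 1 - ‖z‖ ^ 2 := by
    rw [h1]
    exact (Finset.single_le_sum (f := fun j => p a * p j * (1 - Real.cos (t * (lam a - lam j))))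
      (fun j _ => hnn a j) (Finset.mem_univ b)).trans
      (Finset.single_le_sum
        (f := fun i => ∑ j, p i * p j * (1 - Real.cos (t * (lam i - lam j))))
        (fun i _ => Finset.sum_nonneg fun j _ => hnn i j) (Finset.mem_univ a))
  have h3 := Real.cos_le_one_sub_mul_cos_sq ht
  have h4 : ‖z‖ ^ 2 ≤ 1 - p a * p b * (2 / Real.pi ^ 2 * (t * (lam a - lam b)) ^ 2) := by
    have := mul_le_mul_of_nonneg_left h3 (mul_nonneg (hp a) (hp b))
    linarith
  -- Comparing squares absorbs the 2 of the bound cos x ≤ 1 - 2x²/π².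
  refine (sq_le_sq₀ (norm_nonneg _) (Real.exp_pos _).le).mp ?_
  rw [← Real.exp_nat_mul]
  refine h4.trans (le_trans ?_ (Real.add_one_le_exp _))
  apply le_of_eq
  push_cast
  ring

/-- Spreading of the energy of many copies on the scale of the number of input copies. -/
theorem tendsto_integral_norm_pow [Fintype ι] {p : ι → ℝ} (lam : ι → ℝ) (hp : ∀ i, 0 ≤ p i)
    (hp1 : ∑ i, p i = 1) {a b : ι} (ha : 0 < p a) (hb : 0 < p b) (hab : lam a ≠ lam b)
    {Δ c ε : ℝ} (hΔ : 0 < Δ) (hc : 0 < c) (hε : 0 < ε) (M : ℕ → ℕ)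
    (hM : ∀ N : ℕ, c * (N : ℝ) ^ (2 + ε) ≤ (M N : ℝ)) :
    Filter.Tendsto (fun N : ℕ =>
      ∫ g, ‖∑ i, (p i : ℂ) * Complex.exp ((g / (N * Δ) : ℝ) * Complex.I * lam i)‖ ^ M N
        ∂(gaussianReal 0 1)) Filter.atTop (nhds 0) := by
  have hle1 : ∀ t : ℝ, ‖∑ i, (p i : ℂ) * Complex.exp (t * Complex.I * lam i)‖ ≤ 1 := by
    intro t
    refine (norm_sum_le _ _).trans (le_of_eq ?_)
    rw [← hp1]
    refine Finset.sum_congr rfl fun i _ => ?_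
    rw [norm_mul, mul_right_comm, ← Complex.ofReal_mul, Complex.norm_exp_ofReal_mul_I, mul_one,
      Complex.norm_real, Real.norm_of_nonneg (hp i)]
  have := nullSingletonClass_gaussianReal (μ := 0) (v := 1) one_ne_zero
  have hzero : (0 : ℝ) = ∫ _ : ℝ, (0 : ℝ) ∂(gaussianReal 0 1) := by simp
  conv in nhds 0 => rw [hzero]
  refine tendsto_integral_of_dominated_convergence (fun _ => 1)
    (fun N => Continuous.aestronglyMeasurable (by fun_prop)) (integrable_const _)
    (fun N => Filter.Eventually.of_forall fun g => ?_) ?_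
  · rw [Real.norm_of_nonneg (by positivity)]
    exact pow_le_one₀ (norm_nonneg _) (hle1 _)
  -- At `g = 0` the integrand is 1 for every `N`; this point must be discarded.
  have h0 : ∀ᵐ g ∂(gaussianReal 0 1), g ≠ 0 := by
    rw [ae_iff]
    simp
  filter_upwards [h0] with g hg
  set k : ℝ := p a * p b * (lam a - lam b) ^ 2 / Real.pi ^ 2 with hk
  have hkpos : 0 < k := by
    have : lam a - lam b ≠ 0 := sub_ne_zero.mpr hab
    have := Real.pi_pos
    positivity
  have hbig : Filter.Tendsto (fun N : ℕ => -(k * (g / Δ) ^ 2 * c * (N : ℝ) ^ ε))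
      Filter.atTop Filter.atBot := by
    refine Filter.tendsto_neg_atTop_atBot.comp (Filter.Tendsto.const_mul_atTop ?_
      ((tendsto_rpow_atTop hε).comp tendsto_natCast_atTop_atTop))
    have : g / Δ ≠ 0 := div_ne_zero hg hΔ.ne'
    positivity
  refine squeeze_zero' (Filter.Eventually.of_forall fun N => by positivity) ?_
    (Real.tendsto_exp_atBot.comp hbig)
  have hsmall : Filter.Tendsto (fun N : ℕ => |g / (N * Δ) * (lam a - lam b)|)
      Filter.atTop (nhds 0) := by
    have : Filter.Tendsto (fun N : ℕ => (g / Δ * (lam a - lam b)) / (N : ℝ))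
        Filter.atTop (nhds 0) := tendsto_const_div_atTop_nhds_zero_nat _
    rw [← abs_zero]
    refine (this.congr fun N => ?_).abs
    rw [mul_comm (N : ℝ), ← div_div, div_mul_eq_mul_div, div_mul_eq_mul_div, div_right_comm]
    ring
  filter_upwards [hsmall.eventually_le_const Real.pi_pos, Filter.eventually_ge_atTop 1]
    with N hN hN1
  have hNpos : (0 : ℝ) < N := by exact_mod_cast hN1
  refine (pow_le_pow_left₀ (norm_nonneg _) (norm_sum_mul_exp_le lam hp hp1 a b hN) _).trans ?_
  rw [← Real.exp_nat_mul, Function.comp_apply, Real.exp_le_exp, ← hk]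
  -- The factor N² of the window scale cancels, leaving the divergent N^ε in the exponent.
  have h5 : (g / (N * Δ)) ^ 2 * (c * (N : ℝ) ^ (2 + ε)) = (g / Δ) ^ 2 * c * (N : ℝ) ^ ε := by
    rw [Real.rpow_add hNpos, Real.rpow_two]
    field_simp
  have h6 := mul_le_mul_of_nonneg_left (hM N)
    (mul_nonneg hkpos.le (sq_nonneg (g / (N * Δ))))
  rw [mul_assoc, h5] at h6
  linarith

/-! ### Clock states and processes in the eigenbasis -/

/-- If all nonzero components of ψ shared one eigenvalue, ψ would be an eigenvector. -/
theorem exists_ne_of_not_eigenvector [Fintype ι] [DecidableEq ι] {H V : Matrix ι ι ℂ} {lam : ι → ℝ}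
    (hV : V * Vᴴ = 1) (hH : H = V * Matrix.diagonal (fun i => (lam i : ℂ)) * Vᴴ)
    {ψ : ι → ℂ} (hψ : star ψ ⬝ᵥ ψ = 1) (hψH : ¬ ∃ E : ℝ, H *ᵥ ψ = (E : ℂ) • ψ) :
    ∃ a b, (Vᴴ *ᵥ ψ) a ≠ 0 ∧ (Vᴴ *ᵥ ψ) b ≠ 0 ∧ lam a ≠ lam b := by
  have hψV : V *ᵥ (Vᴴ *ᵥ ψ) = ψ := by rw [Matrix.mulVec_mulVec, hV, Matrix.one_mulVec]
  have hne : Vᴴ *ᵥ ψ ≠ 0 := by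
    intro h
    rw [h, Matrix.mulVec_zero] at hψV
    simp [← hψV] at hψ
  obtain ⟨a, ha⟩ := Function.ne_iff.mp hne
  by_contra! hcon
  refine hψH ⟨lam a, ?_⟩
  rw [hH, ← Matrix.mulVec_mulVec, ← Matrix.mulVec_mulVec]
  conv_rhs => rw [← hψV, ← Matrix.mulVec_smul]
  congr 1
  ext i
  rw [Matrix.mulVec_diagonal, Pi.smul_apply, smul_eq_mul]
  by_cases hi : (Vᴴ *ᵥ ψ) i = 0
  · simp [hi]
  · rw [hcon a i ha hi]

theorem sum_norm_sq_conjTranspose_mulVec [Fintype ι] [DecidableEq ι] {V : Matrix ι ι ℂ}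
    (hV : V * Vᴴ = 1) {ψ : ι → ℂ} (hψ : star ψ ⬝ᵥ ψ = 1) : ∑ i, ‖(Vᴴ *ᵥ ψ) i‖ ^ 2 = 1 := by
  have h : star (Vᴴ *ᵥ ψ) ⬝ᵥ (Vᴴ *ᵥ ψ) = 1 := by
    rw [Matrix.star_mulVec, Matrix.conjTranspose_conjTranspose, ← Matrix.dotProduct_mulVec,
      Matrix.mulVec_mulVec, hV, Matrix.one_mulVec, hψ]
  have h2 := congrArg Complex.re h
  simp only [dotProduct, Complex.re_sum, Pi.star_apply, Complex.one_re] at h2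
  rw [← h2]
  refine Finset.sum_congr rfl fun i _ => ?_
  rw [← Complex.normSq_eq_norm_sq, ← starRingEnd_apply, mul_comm, Complex.mul_conj,
    Complex.ofReal_re]

namespace ReplicationProcess

variable [Fintype ι] [DecidableEq ι] {H : Matrix ι ι ℂ} {N M : ℕ}

theorem output_posSemidef (P : ReplicationProcess H N M) (ψ : ι → ℂ) (t : ℝ) :
    (P.output ψ t).PosSemidef := by
  rw [← Matrix.nonneg_iff_posSemidef, output]
  exact map_nonneg P.map (Matrix.nonneg_iff_posSemidef.mpr (Matrix.posSemidef_vecMulVec_self_star _))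

theorem fidelity_nonneg (P : ReplicationProcess H N M) (ψ : ι → ℂ) (t : ℝ) :
    0 ≤ P.fidelity ψ t := by
  refine div_nonneg ?_ ?_
  · exact (Complex.le_def.mp ((P.output_posSemidef ψ t).dotProduct_mulVec_nonneg _)).1
  · exact (Complex.le_def.mp (P.output_posSemidef ψ t).trace_nonneg).1

/-- The process in the product eigenbasis of the Hamiltonian. -/
def mapInBasis (P : ReplicationProcess H N M) (V : Matrix ι ι ℂ) :
    Matrix (Fin N → ι) (Fin N → ι) ℂ →ₗ[ℂ] Matrix (Fin M → ι) (Fin M → ι) ℂ where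
  toFun X := (tensorPowerMat M V)ᴴ *
    P.map (tensorPowerMat N V * X * (tensorPowerMat N V)ᴴ) * tensorPowerMat M V
  map_add' X Y := by simp only [mul_add, add_mul, map_add]
  map_smul' a X := by
    simp only [Matrix.mul_smul, Matrix.smul_mul, map_smul, RingHom.id_apply]

theorem tensorPowerMat_timeEvolution {V : Matrix ι ι ℂ} {lam : ι → ℝ} {t : ℝ}
    (hU : timeEvolution H t =
      V * Matrix.diagonal (fun i => Complex.exp (-(Complex.I * t * lam i))) * Vᴴ) (n : ℕ) :
    tensorPowerMat n (timeEvolution H t) = tensorPowerMat n V *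
      Matrix.diagonal (fun x => Complex.exp (-(Complex.I * t) * totalEnergy lam x)) *
      (tensorPowerMat n V)ᴴ := by
  simp only [← neg_mul] at hU
  rw [hU, tensorPowerMat_mul, tensorPowerMat_mul, tensorPowerMat_diagonal, tensorPowerVec_exp,
    tensorPowerMat_conjTranspose]
  simp only [neg_mul]

/-- Tensor powers of `V` diagonalize the evolutions on both sides, which puts covariance in the form
needed by `apply_eq_zero_of_covariant`. -/
theorem mapInBasis_covariant (P : ReplicationProcess H N M) {V : Matrix ι ι ℂ} {lam : ι → ℝ}
    (hV : Vᴴ * V = 1)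
    (hU : ∀ t : ℝ, timeEvolution H t =
      V * Matrix.diagonal (fun i => Complex.exp (-(Complex.I * t * lam i))) * Vᴴ)
    (t : ℝ) (X : Matrix (Fin N → ι) (Fin N → ι) ℂ) :
    Matrix.diagonal (fun u => Complex.exp (-(Complex.I * t) * totalEnergy lam u)) *
        P.mapInBasis V X *
        (Matrix.diagonal fun u => Complex.exp (-(Complex.I * t) * totalEnergy lam u))ᴴ =
      P.mapInBasis V
        (Matrix.diagonal (fun x => Complex.exp (-(Complex.I * t) * totalEnergy lam x)) * X *
        (Matrix.diagonal fun x => Complex.exp (-(Complex.I * t) * totalEnergy lam x))ᴴ) := by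
  have hW : ∀ n, (tensorPowerMat n V)ᴴ * tensorPowerMat n V = 1 := fun n => by
    rw [← tensorPowerMat_conjTranspose, ← tensorPowerMat_mul, hV, tensorPowerMat_one]
  have hW' : ∀ n (Y : Matrix (Fin n → ι) (Fin n → ι) ℂ),
      (tensorPowerMat n V)ᴴ * (tensorPowerMat n V * Y) = Y := fun n Y => by
    rw [← Matrix.mul_assoc, hW, Matrix.one_mul]
  have h := P.covariant t (tensorPowerMat N V * X * (tensorPowerMat N V)ᴴ)
  rw [tensorPowerMat_timeEvolution (hU t), tensorPowerMat_timeEvolution (hU t)] at h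
  have h2 := congrArg (fun Y => (tensorPowerMat M V)ᴴ * Y * tensorPowerMat M V) h
  simp only [Matrix.conjTranspose_mul, Matrix.conjTranspose_conjTranspose, Matrix.mul_assoc, hW',
    hW, Matrix.mul_one] at h2
  simp only [mapInBasis, LinearMap.coe_mk, AddHom.coe_mk, Matrix.mul_assoc]
  exact h2

/-- The fidelity is at most the largest probability of an energy window whose half-width is the
energy range of the input. -/
theorem fidelity_zero_le (P : ReplicationProcess H N M) {V : Matrix ι ι ℂ} {lam : ι → ℝ}
    (hV : Vᴴ * V = 1) (hV' : V * Vᴴ = 1)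
    (hU : ∀ t : ℝ, timeEvolution H t =
      V * Matrix.diagonal (fun i => Complex.exp (-(Complex.I * t * lam i))) * Vᴴ)
    {Δ : ℝ} (hΔ : ∀ i j, |lam i - lam j| ≤ Δ) (ψ : ι → ℂ)
    (hP : 0 < P.successProbability ψ 0) {δ : ℝ}
    (hδ : ∀ s, (∑ x : Fin M → ι, if |totalEnergy lam x - s| ≤ N * Δ then
      ∏ j, ‖(Vᴴ *ᵥ ψ) (x j)‖ ^ 2 else 0) ≤ δ) :
    P.fidelity ψ 0 ≤ δ := by
  have hψ0 : clockState H ψ 0 = ψ := by rw [clockState, timeEvolution_zero, Matrix.one_mulVec]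
  have hW : tensorPowerMat M V * (tensorPowerMat M V)ᴴ = 1 := by
    rw [← tensorPowerMat_conjTranspose, ← tensorPowerMat_mul, hV', tensorPowerMat_one]
  have hWN : tensorPowerMat N V * (tensorPowerMat N V)ᴴ = 1 := by
    rw [← tensorPowerMat_conjTranspose, ← tensorPowerMat_mul, hV', tensorPowerMat_one]
  set W := tensorPowerMat M V with hWdef
  set ρ := P.output ψ 0 with hρ
  set X := (tensorPowerMat N V)ᴴ * pureState (tensorPowerVec N (clockState H ψ 0)) *
    tensorPowerMat N V with hX
  have hB : P.mapInBasis V X = Wᴴ * ρ * W := by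
    simp only [mapInBasis, LinearMap.coe_mk, AddHom.coe_mk, hρ, output]
    congr 3
    rw [hX, Matrix.mul_assoc, Matrix.mul_assoc, Matrix.mul_assoc, hWN, Matrix.mul_one,
      ← Matrix.mul_assoc, hWN, Matrix.one_mul]
  have hpsd : (Wᴴ * ρ * W).PosSemidef := (P.output_posSemidef ψ 0).conjTranspose_mul_mul_same W
  have htr : (Wᴴ * ρ * W).trace = ρ.trace := by
    rw [Matrix.trace_mul_comm, ← Matrix.mul_assoc, hW, Matrix.one_mul]
  have hband : ∀ u v, N * Δ < |totalEnergy lam u - totalEnergy lam v| → (Wᴴ * ρ * W) u v = 0 := by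
    intro u v huv
    rw [← hB]
    exact apply_eq_zero_of_covariant (P.mapInBasis V) (totalEnergy lam) (totalEnergy lam)
      (P.mapInBasis_covariant hV hU) (abs_totalEnergy_sub_le hΔ) X huv
  have hov := re_dotProduct_mulVec_le_of_banded hpsd (totalEnergy lam) (N * Δ) hband
    (tensorPowerVec M (Vᴴ *ᵥ ψ)) δ (fun s => by
      simpa only [tensorPowerVec, norm_prod, Finset.prod_pow] using hδ s)
  have hΦ : W *ᵥ tensorPowerVec M (Vᴴ *ᵥ ψ) = tensorPowerVec M ψ := by
    rw [hWdef, ← tensorPowerMat_mulVec, Matrix.mulVec_mulVec, hV', Matrix.one_mulVec]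
  have hΦ' : star (tensorPowerVec M (Vᴴ *ᵥ ψ)) ᵥ* Wᴴ = star (tensorPowerVec M ψ) := by
    rw [← Matrix.star_mulVec, hΦ]
  rw [htr, ← Matrix.mulVec_mulVec, hΦ, ← Matrix.mulVec_mulVec, Matrix.dotProduct_mulVec, hΦ'] at hov
  rw [fidelity, div_le_iff₀ hP, hψ0]
  exact hov

end ReplicationProcess

end Replication

end

/-! ### The strong converse -/

open Replication in
theorem mainTheorem1 {ι : Type*} [Fintype ι] [DecidableEq ι]
    (H : Matrix ι ι ℂ) (hH : H.IsHermitian)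
    (ψ : ι → ℂ) (hψ : star ψ ⬝ᵥ ψ = 1)
    (hψH : ¬ ∃ E : ℝ, H *ᵥ ψ = (E : ℂ) • ψ)
    (c ε : ℝ) (hc : 0 < c) (hε : 0 < ε)
    (M : ℕ → ℕ) (hM : ∀ N : ℕ, c * (N : ℝ) ^ (2 + ε) ≤ (M N : ℝ))
    (P : ∀ N : ℕ, Replication.ReplicationProcess H N (M N))
    (hP : ∀ (N : ℕ) (t : ℝ), 0 < (P N).successProbability ψ t) :
    Filter.Tendsto (fun N : ℕ => (P N).worstCaseFidelity ψ) Filter.atTop (nhds 0) := by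
  obtain ⟨V, lam, hV, hV', hHV, hU⟩ := exists_timeEvolution_eq hH
  obtain ⟨a, b, ha, hb, hab⟩ := exists_ne_of_not_eigenvector hV' hHV hψ hψH
  have hp1 := sum_norm_sq_conjTranspose_mulVec hV' hψ
  set p : ι → ℝ := fun i => ‖(Vᴴ *ᵥ ψ) i‖ ^ 2 with hp
  have hp0 : ∀ i, 0 ≤ p i := fun i => by positivity
  have hpa : 0 < p a := by have := norm_pos_iff.mpr ha; positivity
  have hpb : 0 < p b := by have := norm_pos_iff.mpr hb; positivity
  -- Any positive bound on the eigenvalue gaps would serve.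
  set Δ : ℝ := ∑ i, ∑ j, |lam i - lam j| with hΔdef
  have hΔ : ∀ i j, |lam i - lam j| ≤ Δ := fun i j =>
    (Finset.single_le_sum (f := fun j => |lam i - lam j|) (fun _ _ => abs_nonneg _)
      (Finset.mem_univ j)).trans
    (Finset.single_le_sum (f := fun i => ∑ j, |lam i - lam j|)
      (fun _ _ => Finset.sum_nonneg fun _ _ => abs_nonneg _) (Finset.mem_univ i))
  have hΔ0 : 0 < Δ := (abs_pos.mpr (sub_ne_zero.mpr hab)).trans_le (hΔ a b)
  have hlim := (tendsto_integral_norm_pow lam hp0 hp1 hpa hpb hab hΔ0 hc hε M hM).const_mul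
    (Real.exp (1 / 2))
  rw [mul_zero] at hlim
  refine squeeze_zero' (Filter.Eventually.of_forall fun N =>
    Real.iInf_nonneg fun t => (P N).fidelity_nonneg ψ t) ?_ hlim
  filter_upwards [Filter.eventually_ge_atTop 1] with N hN
  have hbdd : BddBelow (Set.range fun t => (P N).fidelity ψ t) :=
    ⟨0, by rintro _ ⟨t, rfl⟩; exact (P N).fidelity_nonneg ψ t⟩
  -- The single time 0 already forces the infimum to vanish in the limit.
  refine (ciInf_le hbdd 0).trans
    ((P N).fidelity_zero_le hV hV' hU hΔ ψ (hP N 0) fun s => ?_)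
  have hD : (0 : ℝ) < N * Δ := mul_pos (by exact_mod_cast hN) hΔ0
  have h := sum_ite_abs_sub_le_integral (fun x : Fin (M N) → ι => ∏ j, p (x j))
    (fun x => Finset.prod_nonneg fun j _ => hp0 (x j)) (totalEnergy lam) hD s
  simpa only [sum_prod_mul_exp_totalEnergy, norm_pow] using h
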